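/- **Setting.** Let $R$ be a commutative ring with $m$ commuting derivations $\partial_1,\dots,\partial_m$. A differential extension $\tilde R\supset R$ is a commutative ring containing $R$, with $m$ commuting derivations extending those of $R$. In a differential ring write $a\sim b$ if $a-b\in\sum_l \operatorname{Im}\partial_l$, and for vectors put $\langle u,X\rangle=\sum_i u_iX_i$. Let $\mathcal G=R^N$ be a differential Lie algebra: its bracket $[\ ,\ ]$ is a bilinear differential operator with coefficients in $R$ that is skew and satisfies the Jacobi identity over every differential extension of $R$. For $X\in\mathcal G$ the coadjoint action is $X.u=-(\operatorname{ad}X)^\dagger(u)$, where $\dagger$ is the formal adjoint, so that $\langle X.u,Y\rangle\sim-\langle u,[X,Y]\rangle$. Let $b:\mathcal G\to\mathcal G^*=R^N$ be a matrix differential operator over $R$ which is skewsymmetric and defines a generalized 2-cocycle: $$\langle b(X),Y\rangle\sim-\langle b(Y),X\rangle,\qquad \langle b([X,Y]),Z\rangle+\langle b([Y,Z]),X\rangle+\langle b([Z,X]),Y\rangle\sim0$$ for all vectors $X,Y,Z$ over every differential extension of $R$. Let $C_u=R[u_i^{(\sigma)}]$ $(1\le i\le N,\ \sigma\in\mathbf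 Z_{\ge0}^m)$ be the ring of differential polynomials, with $\partial_l u_i^{(\sigma)}=u_i^{(\sigma+e_l)}$, let $\frac{\delta H}{\delta u_i}=\sum_\sigma(-\partial)^\sigma\frac{\partial H}{\partial u_i^{(\sigma)}}$, and consider the affine Poisson bracket on $C_u$ (defined modulo $\sim$) $$\{H,F\}\sim\Big\langle u,\Big[\frac{\delta H}{\delta u},\frac{\delta F}{\delta u}\Big]\Big\rangle+\Big\langle b\Big(\frac{\delta H}{\delta u}\Big),\frac{\delta F}{\delta u}\Big\rangle .$$ For $X\in\mathcal G$ let $X^\wedge$ be the evolution derivation of $C_u$ (an $R$-linear derivation commuting with all $\partial_l$) determined by $$X^\wedge(u)=X.u-b(X).$$ **Theorem 5.55.** The map $X\mapsto X^\wedge$ is an action of $\mathcal G$ on $C_u$, i.e. an antirepresentation of $\mathcal G$ by evolution derivations: it is additive, linear over the constants $\{k\in R:\partial_l k=0\ \forall l\}$, and $[X,Y]^\wedge=-(X^\wedge Y^\wedge-Y^\wedge X^\wedge)$ for all $X,Y\in\mathcal G$. It satisfies the infinitesimal Hamiltonian action criterion $$X^\wedge(\{H,F\})-\{X^\wedge(H),F\}-\{H,X^\wedge(F)\}\sim\langle[H^\sim,F^\sim],X\rangle\qquad\forall\,H,F\in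 C_u,\ \forall\,X\in\mathcal G,$$ for the affine bracket, where $\mathcal G^*$ is regarded as an abelian Lie algebra. Here $H\mapsto H^\sim\in C_u\otimes\mathcal G^*=C_u^N$ denotes a map with $\langle H^\sim,X\rangle\sim X^\wedge(H)$ for all $X\in\mathcal G$; such a map exists. As the commutator of $\mathcal G^*$ is zero, the right-hand side is $0$, i.e. $$X^\wedge(\{H,F\})\sim\{X^\wedge(H),F\}+\{H,X^\wedge(F)\}.$$ -/

import Mathlib

open MvPolynomial

/-- A commutative ring with `m` commuting derivations `∂ 0, …, ∂ (m-1)`. -/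
class PartialDiffRing (m : ℕ) (S : Type*) [CommRing S] where
  der : Fin m → Derivation ℤ S S
  der_comm : ∀ (l l' : Fin m) (a : S), der l (der l' a) = der l' (der l a)

section Calculus

variable {m : ℕ} {S : Type*} [CommRing S] [PartialDiffRing m S]

/-- The derivation `∂_l` of a differential ring. -/
abbrev pd (l : Fin m) : Derivation ℤ S S := PartialDiffRing.der l

/-- The iterated derivation `∂^σ = ∂_0^(σ 0) ⋯ ∂_(m-1)^(σ (m-1))`. -/
noncomputable def dpow (σ : Fin m → ℕ) : Module.End ℤ S :=
  ((List.finRange m).map fun l => ((pd l : Derivation ℤ S S) : Module.End ℤ S) ^ σ l).prod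

/-- The formal adjoint `(-∂)^σ = (-1)^|σ| ∂^σ` of `∂^σ`. -/
noncomputable def adjDpow (σ : Fin m → ℕ) (a : S) : S := (-1) ^ (∑ l, σ l) * dpow σ a

variable (m) in
/-- The relation `a ∼ b`: the difference lies in `∑ l, Im ∂_l`. -/
def DivEquiv (a b : S) : Prop := ∃ w : Fin m → S, a - b = ∑ l, pd l (w l)

/-- The pairing `⟨u, X⟩ = ∑ i, u i * X i`. -/
def pairing {N : ℕ} (u X : Fin N → S) : S := ∑ i, u i * X i

end Calculus

/-- A differential extension: an injective algebra map commuting with the derivations. -/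
class DiffExtension (m : ℕ) (R S : Type*) [CommRing R] [CommRing S] [PartialDiffRing m R]
    [PartialDiffRing m S] [Algebra R S] : Prop where
  injective : Function.Injective (algebraMap R S)
  map_der : ∀ (l : Fin m) (a : R), pd l (algebraMap R S a) = algebraMap R S (pd l a)

/-- Jets: the pair `(i, σ)` stands for `∂^σ` of the `i`-th component. -/
abbrev Jet (m N : ℕ) := Fin N × (Fin m → ℕ)

/-- Matrix differential operators `R^N → R^N`; the coefficient of `b i` at `(j, σ)`
is the coefficient of `∂^σ X_j` in the `i`-th component. -/
abbrev DiffOp (m N : ℕ) (R : Type*) [CommRing R] := Fin N → (Jet m N →₀ R)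

/-- Bilinear differential operators `R^N × R^N → R^N`; the coefficient of `c k` at
`((i, σ), (j, τ))` is the coefficient of `∂^σ X_i * ∂^τ Y_j` in the `k`-th component. -/
abbrev BiDiffOp (m N : ℕ) (R : Type*) [CommRing R] := Fin N → (Jet m N × Jet m N →₀ R)

section Operators

variable {m N : ℕ} {R S : Type*} [CommRing R] [CommRing S] [PartialDiffRing m S] [Algebra R S]

/-- The action of a differential operator over `R` on vectors over an extension `S`. -/
noncomputable def DiffOp.app (b : DiffOp m N R) (X : Fin N → S) : Fin N → S := fun i =>
  (b i).sum fun p a => algebraMap R S a * dpow p.2 (X p.1)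

/-- The action of a bilinear differential operator over `R` on vectors over an extension `S`. -/
noncomputable def BiDiffOp.app (c : BiDiffOp m N R) (X Y : Fin N → S) : Fin N → S := fun k =>
  (c k).sum fun p a => algebraMap R S a * dpow p.1.2 (X p.1.1) * dpow p.2.2 (Y p.2.1)

/-- The coadjoint action `X.u = -(ad X)† u`, where `ad X = [X, ·]` and `†` is the formal adjoint. -/
noncomputable def coadj (c : BiDiffOp m N R) (X u : Fin N → S) : Fin N → S := fun j =>
  -∑ k, (c k).sum fun p a =>
    if p.2.1 = j then adjDpow p.2.2 (u k * (algebraMap R S a * dpow p.1.2 (X p.1.1))) else 0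

end Operators

universe u

/-- The bilinear differential operator `c` makes `R^N` into a differential Lie algebra: it is
skew and satisfies the Jacobi identity over every differential extension of `R`. -/
structure IsDiffLieAlgebra {m N : ℕ} {R : Type u} [CommRing R] [PartialDiffRing m R]
    (c : BiDiffOp m N R) : Prop where
  skew : ∀ (S : Type u) [CommRing S] [PartialDiffRing m S] [Algebra R S] [DiffExtension m R S]
    (X Y : Fin N → S), c.app X Y = -c.app Y X
  jacobi : ∀ (S : Type u) [CommRing S] [PartialDiffRing m S] [Algebra R S] [DiffExtension m R S]
    (X Y Z : Fin N → S),
    c.app (c.app X Y) Z + c.app (c.app Y Z) X + c.app (c.app Z X) Y = 0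

/-- The differential operator `b : 𝒢 → 𝒢*` is skewsymmetric and `⟨b X, Y⟩` is a generalized
2-cocycle on the Lie algebra with bracket `c`, over every differential extension of `R`. -/
structure IsGenTwoCocycle {m N : ℕ} {R : Type u} [CommRing R] [PartialDiffRing m R]
    (c : BiDiffOp m N R) (b : DiffOp m N R) : Prop where
  skew : ∀ (S : Type u) [CommRing S] [PartialDiffRing m S] [Algebra R S] [DiffExtension m R S]
    (X Y : Fin N → S), DivEquiv m (pairing (b.app X) Y) (-pairing (b.app Y) X)
  cocycle : ∀ (S : Type u) [CommRing S] [PartialDiffRing m S] [Algebra R S] [DiffExtension m R S]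
    (X Y Z : Fin N → S),
    DivEquiv m (pairing (b.app (c.app X Y)) Z + pairing (b.app (c.app Y Z)) X
      + pairing (b.app (c.app Z X)) Y) 0

/-- The ring `C_u = R[u_i^(σ)]` of differential polynomials on `𝒢* = R^N`. -/
abbrev DiffPoly (m N : ℕ) (R : Type*) [CommRing R] := MvPolynomial (Jet m N) R

section DiffPoly

variable {m N : ℕ} {R : Type*} [CommRing R]

theorem dcoeff_aux {ι : Type*} (d : Derivation ℤ R R) (p : MvPolynomial ι R) (s : ι →₀ ℕ) :
    coeff s (∑ t ∈ p.support, monomial t (d (coeff t p))) = d (coeff s p) := by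
  classical
  rw [coeff_sum]
  simp only [coeff_monomial]
  rw [Finset.sum_ite_eq' p.support s]
  split_ifs with h
  · rfl
  · rw [notMem_support_iff.1 h, map_zero]

/-- A derivation of `R`, applied to the coefficients of polynomials over `R`. -/
noncomputable def coeffDer {ι : Type*} (d : Derivation ℤ R R) :
    Derivation ℤ (MvPolynomial ι R) (MvPolynomial ι R) :=
  Derivation.mk'
    (AddMonoidHom.toIntLinearMap
      { toFun := fun p => ∑ t ∈ p.support, monomial t (d (coeff t p))
        map_zero' := by simp
        map_add' := fun p q => by
          ext s
          rw [coeff_add, dcoeff_aux, dcoeff_aux, dcoeff_aux, coeff_add, map_add] })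
    (fun p q => by
      classical
      ext s
      change coeff s (∑ t ∈ (p * q).support, monomial t (d (coeff t (p * q)))) =
        coeff s (p * (∑ t ∈ q.support, monomial t (d (coeff t q))) +
          q * (∑ t ∈ p.support, monomial t (d (coeff t p))))
      rw [dcoeff_aux, coeff_add, mul_comm q, coeff_mul, coeff_mul, coeff_mul, map_sum,
        ← Finset.sum_add_distrib]
      refine Finset.sum_congr rfl fun x _ => ?_
      rw [dcoeff_aux, dcoeff_aux, Derivation.leibniz, smul_eq_mul, smul_eq_mul,
        mul_comm (coeff x.2 q)])

theorem coeff_coeffDer {ι : Type*} (d : Derivation ℤ R R) (p : MvPolynomial ι R) (s : ι →₀ ℕ) :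
    coeff s (coeffDer d p) = d (coeff s p) := dcoeff_aux d p s

theorem coeffDer_C {ι : Type*} (d : Derivation ℤ R R) (a : R) :
    coeffDer d (C a : MvPolynomial ι R) = C (d a) := by
  classical
  ext s
  rw [coeff_coeffDer, coeff_C, coeff_C]
  split_ifs <;> simp

theorem coeffDer_X {ι : Type*} (d : Derivation ℤ R R) (i : ι) :
    coeffDer d (X i : MvPolynomial ι R) = 0 := by
  classical
  ext s
  rw [coeff_coeffDer, coeff_X, coeff_zero]
  split_ifs <;> simp

variable [PartialDiffRing m R]

/-- The total derivation `∂_l` of `C_u`: it extends `∂_l` on `R` and maps `u_i^(σ)` to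
`u_i^(σ + e_l)`. -/
noncomputable def totalDer (l : Fin m) : Derivation ℤ (DiffPoly m N R) (DiffPoly m N R) :=
  coeffDer (pd l) + (mkDerivation R fun p : Jet m N =>
    (X (p.1, p.2 + Pi.single l 1) : DiffPoly m N R)).restrictScalars ℤ

theorem totalDer_C (l : Fin m) (a : R) :
    totalDer l (C a : DiffPoly m N R) = C (pd l a) := by
  simp [totalDer, coeffDer_C]

theorem totalDer_X (l : Fin m) (p : Jet m N) :
    totalDer l (X p : DiffPoly m N R) = X (p.1, p.2 + Pi.single l 1) := by
  simp [totalDer, coeffDer_X, mkDerivation_X]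

noncomputable instance : PartialDiffRing m (DiffPoly m N R) where
  der := totalDer
  der_comm l l' a := by
    have h : ⁅(totalDer l : Derivation ℤ (DiffPoly m N R) (DiffPoly m N R)), totalDer l'⁆ a
        = 0 := by
      induction a using MvPolynomial.induction_on with
      | C r =>
        rw [Derivation.commutator_apply, totalDer_C, totalDer_C, totalDer_C, totalDer_C,
          PartialDiffRing.der_comm, sub_self]
      | add p q hp hq => rw [map_add, hp, hq, add_zero]
      | mul_X p i hp =>
        rw [Derivation.leibniz, hp, Derivation.commutator_apply, totalDer_X, totalDer_X,
          totalDer_X, totalDer_X, add_right_comm]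
        simp
    rw [Derivation.commutator_apply] at h
    exact sub_eq_zero.1 h

instance : DiffExtension m R (DiffPoly m N R) where
  injective := MvPolynomial.C_injective _ _
  map_der l a := totalDer_C l a

/-- The generator `u_i` of `C_u`, as a vector. -/
noncomputable def uVec : Fin N → DiffPoly m N R := fun i => X (i, 0)

/-- A vector over `R`, seen as a vector over `C_u`. -/
noncomputable def constVec (X : Fin N → R) : Fin N → DiffPoly m N R := fun i => C (X i)

/-- The variational derivative `δH/δu_i = ∑ σ, (-∂)^σ (∂H/∂u_i^(σ))`; only the variables that
occur in `H` contribute to the sum. -/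
noncomputable def varDer (H : DiffPoly m N R) : Fin N → DiffPoly m N R := fun i =>
  ∑ p ∈ H.vars, if p.1 = i then adjDpow p.2 (pderiv p H) else 0

/-- The evolution derivation of `C_u` over `R` with `u_i ↦ a_i`, hence `u_i^(σ) ↦ ∂^σ a_i`. -/
noncomputable def evolDer (a : Fin N → DiffPoly m N R) :
    Derivation R (DiffPoly m N R) (DiffPoly m N R) :=
  mkDerivation R fun p => dpow p.2 (a p.1)

/-- The affine bracket `⟨u, [δH/δu, δF/δu]⟩ + ⟨b(δH/δu), δF/δu⟩`; as for every bracket of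
functionals, only its class modulo `∼` matters. -/
noncomputable def affineBracket (c : BiDiffOp m N R) (b : DiffOp m N R)
    (H F : DiffPoly m N R) : DiffPoly m N R :=
  pairing uVec (c.app (varDer H) (varDer F)) + pairing (b.app (varDer H)) (varDer F)

/-- The modified action: the evolution derivation `X^` with `X^(u) = X.u - b(X)`. -/
noncomputable def modifiedAction (c : BiDiffOp m N R) (b : DiffOp m N R) (X : Fin N → R) :
    Derivation R (DiffPoly m N R) (DiffPoly m N R) :=
  evolDer (coadj c (constVec X) uVec - b.app (constVec X))

/-- An antirepresentation of the differential Lie algebra `(R^N, c)` in the Lie algebra of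
evolution derivations of `C_u` (the derivations over `R` that commute with all `∂_l`). -/
structure IsEvolutionAntirep (c : BiDiffOp m N R)
    (hat : (Fin N → R) → Derivation R (DiffPoly m N R) (DiffPoly m N R)) : Prop where
  evolution : ∀ X (l : Fin m) (H : DiffPoly m N R), hat X (pd l H) = pd l (hat X H)
  map_add : ∀ X Y, hat (X + Y) = hat X + hat Y
  map_const_smul : ∀ (k : R), (∀ l : Fin m, pd l k = 0) → ∀ X, hat (k • X) = k • hat X
  map_bracket : ∀ X Y, hat (c.app X Y) = -⁅hat X, hat Y⁆

/-- The map `H ↦ H~ ∈ C_u ⊗ 𝒢*` is given by `⟨H~, X⟩ ∼ X^(H)` for all `X`. -/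
def IsDualMap (hat : (Fin N → R) → Derivation R (DiffPoly m N R) (DiffPoly m N R))
    (tld : DiffPoly m N R → Fin N → DiffPoly m N R) : Prop :=
  ∀ H X, DivEquiv m (pairing (tld H) (constVec X)) (hat X H)

/-- The infinitesimal Hamiltonian action criterion
`X^({H,F}) - {X^(H),F} - {H,X^(F)} ∼ ⟨[H~,F~], X⟩`, for a bracket `PB` on `C_u` and a commutator
on `𝒢*` given by the bilinear differential operator `κ`. -/
structure IsInfHamiltonianAction
    (κ : BiDiffOp m N R)
    (PB : DiffPoly m N R → DiffPoly m N R → DiffPoly m N R)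
    (hat : (Fin N → R) → Derivation R (DiffPoly m N R) (DiffPoly m N R)) : Prop where
  exists_dual : ∃ tld, IsDualMap hat tld
  criterion : ∀ tld, IsDualMap hat tld → ∀ H F X,
    DivEquiv m (hat X (PB H F) - PB (hat X H) F - PB H (hat X F))
      (pairing (κ.app (tld H) (tld F)) (constVec X))

end DiffPoly

/-! Everything is computed in the quotient by total divergences, where `∼` becomes equality
(`divEquiv_iff`) and integration by parts (`divClass_mul_dpow`) moves operators across the pairing.

Antirepresentation: evolution derivations are determined by their values on `u`, so the bracket
relation reduces to an identity of vectors. Since `X.u` is linear in `u` and `b(Y)` is free of `u`,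
X^ sends the affine field of `Y` to `Y.(X.u - b(X))` (`modifiedAction_comp_affine`); the exchanged
order produces the minus sign. What remains is that `u ↦ X.u - b(X)` respects brackets
(`affine_coadj_bracket`). Jacobi and the cocycle identity give this only after pairing and modulo
divergences; an exact identity follows by pairing with a generic vector of new differential
indeterminates, which loses nothing (`eq_of_divClass_pairing_uVec`).

Hamiltonian criterion: commuting X^ with an arbitrary evolution derivation shows that δ(X^H)/δu
agrees with X^(δH/δu) - [X, δH/δu] when paired with any vector (`divClass_varDer_modifiedAction`).
Each variational derivative enters the affine bracket through such a pairing (`affineForm_eq`), so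
this weak form may be substituted. The Leibniz rule for X^ then leaves the Jacobi identity paired
with `u` and one instance of the cocycle identity. -/

/-! ### Multi-indices -/

section Multiindex

theorem multiindex_induction {m : ℕ} {P : (Fin m → ℕ) → Prop} (zero : P 0)
    (add_single : ∀ σ l, P σ → P (σ + Pi.single l 1)) (σ : Fin m → ℕ) : P σ := by
  induction h : ∑ l, σ l generalizing σ with
  | zero =>
    have : σ = 0 := by
      funext l
      simpa using Finset.sum_eq_zero_iff.1 h l (Finset.mem_univ l)
    exact this ▸ zero
  | succ n ih =>
    obtain ⟨l, -, hl⟩ : ∃ l ∈ Finset.univ, σ l ≠ 0 := by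
      by_contra! h0
      rw [Finset.sum_eq_zero h0] at h
      omega
    have hσ : σ - Pi.single l 1 + Pi.single l 1 = σ := by
      funext k
      by_cases hk : k = l
      · subst hk
        simp
        omega
      · simp [hk]
    rw [← hσ]
    refine add_single _ _ (ih _ ?_)
    rw [← hσ] at h
    simp only [Pi.add_apply, Finset.sum_add_distrib, Finset.sum_pi_single', Finset.mem_univ,
      if_true] at h
    omega

/-- Commutativity pulls the one extra factor `f l` to the front; `Nodup` ensures that it occurs only
once. -/
theorem list_prod_map_pow_add_single {m : ℕ} {M : Type*} [Monoid M] (f : Fin m → M)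
    (hf : ∀ i j, Commute (f i) (f j)) (σ : Fin m → ℕ) (l : Fin m) (L : List (Fin m))
    (hL : L.Nodup) :
    (L.map fun k => f k ^ (σ + Pi.single l 1 : Fin m → ℕ) k).prod =
      (if l ∈ L then f l else 1) * (L.map fun k => f k ^ σ k).prod := by
  induction L with
  | nil => simp
  | cons k L ih =>
    rw [List.nodup_cons] at hL
    rw [List.map_cons, List.prod_cons, ih hL.2, List.map_cons, List.prod_cons]
    by_cases hk : l = k
    · subst hk
      simp [hL.1, pow_succ', mul_assoc]
    · have hc : Commute (f k ^ σ k) (if l ∈ L then f l else 1) := by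
        split_ifs
        · exact (hf k l).pow_left _
        · exact Commute.one_right _
      simp only [Pi.add_apply, Pi.single_apply, Ne.symm hk, if_false, add_zero, List.mem_cons,
        hk, false_or]
      rw [← mul_assoc, hc.eq, mul_assoc]

end Multiindex

/-! ### Iterated derivatives and calculus modulo divergences -/

section Calculus

variable {m : ℕ} {S T : Type*} [CommRing S] [CommRing T] [PartialDiffRing m S]
  [PartialDiffRing m T]

theorem dpow_zero (a : S) : dpow (0 : Fin m → ℕ) a = a := by
  simp [dpow]

theorem dpow_add_single (σ : Fin m → ℕ) (l : Fin m) (a : S) :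
    dpow (σ + Pi.single l 1) a = pd l (dpow σ a) := by
  have h := list_prod_map_pow_add_single
    (fun l => ((pd l : Derivation ℤ S S) : Module.End ℤ S))
    (fun i j => LinearMap.ext fun a => PartialDiffRing.der_comm i j a) σ l (List.finRange m)
    (List.nodup_finRange m)
  rw [if_pos (List.mem_finRange l)] at h
  exact congrArg (fun e : Module.End ℤ S => e a) h

/-- Only additivity of `f` is assumed, so this serves algebra maps, evolution derivations, the `∂_l`
themselves and multiplication by constants alike. -/
theorem map_dpow (f : S →+ T) (hf : ∀ (l : Fin m) a, f (pd l a) = pd l (f a))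
    (σ : Fin m → ℕ) (a : S) : f (dpow σ a) = dpow σ (f a) := by
  induction σ using multiindex_induction with
  | zero => simp [dpow_zero]
  | add_single σ l ih => rw [dpow_add_single, dpow_add_single, hf, ih]

theorem pd_dpow (l : Fin m) (σ : Fin m → ℕ) (a : S) : pd l (dpow σ a) = dpow σ (pd l a) :=
  map_dpow ((pd l : Derivation ℤ S S) : S →+ S)
    (fun l' a => PartialDiffRing.der_comm l l' a) σ a

theorem map_adjDpow (f : S →+ T) (hf : ∀ (l : Fin m) a, f (pd l a) = pd l (f a))
    (σ : Fin m → ℕ) (a : S) : f (adjDpow σ a) = adjDpow σ (f a) := by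
  rw [adjDpow, adjDpow, ← map_dpow f hf]
  rcases Nat.even_or_odd (∑ l, σ l) with h | h <;> simp [h.neg_one_pow]

theorem adjDpow_zero (a : S) : adjDpow (0 : Fin m → ℕ) a = a := by
  simp [adjDpow, dpow_zero]

theorem adjDpow_add_single (σ : Fin m → ℕ) (l : Fin m) (a : S) :
    adjDpow (σ + Pi.single l 1) a = -adjDpow σ (pd l a) := by
  simp only [adjDpow, dpow_add_single, pd_dpow, Pi.add_apply, Finset.sum_add_distrib,
    Finset.sum_pi_single', Finset.mem_univ, if_true, pow_succ]
  ring

theorem adjDpow_add (σ : Fin m → ℕ) (a b : S) :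
    adjDpow σ (a + b) = adjDpow σ a + adjDpow σ b := by
  simp [adjDpow, mul_add]

theorem dpow_const_mul {k : S} (hk : ∀ l : Fin m, pd l k = 0) (σ : Fin m → ℕ) (a : S) :
    dpow σ (k * a) = k * dpow σ a :=
  (map_dpow (AddMonoidHom.mulLeft k) (fun l a => by simp [hk]) σ a).symm

theorem adjDpow_const_mul {k : S} (hk : ∀ l : Fin m, pd l k = 0) (σ : Fin m → ℕ) (a : S) :
    adjDpow σ (k * a) = k * adjDpow σ a := by
  rw [adjDpow, adjDpow, dpow_const_mul hk, mul_left_comm]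

variable (m S) in
/-- The additive group `∑ l, Im ∂_l` of total divergences. -/
def divergences : AddSubgroup S where
  carrier := {a | ∃ w : Fin m → S, a = ∑ l, pd l (w l)}
  zero_mem' := ⟨0, by simp⟩
  add_mem' := by
    rintro _ _ ⟨v, rfl⟩ ⟨w, rfl⟩
    exact ⟨v + w, by simp [Finset.sum_add_distrib]⟩
  neg_mem' := by
    rintro _ ⟨v, rfl⟩
    exact ⟨-v, by simp⟩

variable (m) in
/-- The class of an element modulo total divergences. -/
def divClass : S →+ S ⧸ divergences m S := QuotientAddGroup.mk' _

theorem divEquiv_iff {a b : S} : DivEquiv m a b ↔ divClass m a = divClass m b := by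
  rw [← sub_eq_zero, ← map_sub]
  exact (QuotientAddGroup.eq_zero_iff (N := divergences m S) (a - b)).symm

theorem divClass_pd (l : Fin m) (a : S) : divClass m (pd l a) = 0 := by
  refine (QuotientAddGroup.eq_zero_iff (N := divergences m S) _).2 ⟨Pi.single l a, ?_⟩
  rw [Finset.sum_eq_single l] <;> simp +contextual

/-- An additive map that commutes with all `∂_l` respects equality modulo divergences. -/
theorem divClass_map_congr (f : S →+ T) (hf : ∀ (l : Fin m) a, f (pd l a) = pd l (f a))
    {a b : S} (h : divClass m a = divClass m b) : divClass m (f a) = divClass m (f b) := by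
  obtain ⟨w, hw⟩ := divEquiv_iff.2 h
  rw [← divEquiv_iff]
  exact ⟨fun l => f (w l), by simp [← map_sub, hw, hf]⟩

/-- Integration by parts: the Leibniz rule moves one `∂_l` at a time, each with a change of sign. -/
theorem divClass_mul_dpow (σ : Fin m → ℕ) (a b : S) :
    divClass m (a * dpow σ b) = divClass m (adjDpow σ a * b) := by
  induction σ using multiindex_induction generalizing a with
  | zero => rw [dpow_zero, adjDpow_zero]
  | add_single σ l ih =>
    have h := divClass_pd l (a * dpow σ b)
    rw [Derivation.leibniz, map_add, smul_eq_mul, smul_eq_mul, mul_comm (dpow σ b), ih (pd l a),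
      add_eq_zero_iff_eq_neg] at h
    rw [dpow_add_single, h, adjDpow_add_single, neg_mul, map_neg]

end Calculus

/-! ### Bilinearity of the pairing -/

section Pairing

variable {N : ℕ} {S : Type*} [CommRing S]

theorem pairing_neg_left (u X : Fin N → S) : pairing (-u) X = -pairing u X := by
  simp [pairing]

theorem pairing_sub_left (u v X : Fin N → S) : pairing (u - v) X = pairing u X - pairing v X := by
  simp [pairing, sub_mul]

theorem pairing_comm (u X : Fin N → S) : pairing u X = pairing X u := by
  simp [pairing, mul_comm]

theorem pairing_add_right (u X Y : Fin N → S) :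
    pairing u (X + Y) = pairing u X + pairing u Y := by
  simp [pairing, mul_add, Finset.sum_add_distrib]

theorem pairing_neg_right (u X : Fin N → S) : pairing u (-X) = -pairing u X := by
  simp [pairing]

theorem pairing_sub_right (u X Y : Fin N → S) :
    pairing u (X - Y) = pairing u X - pairing u Y := by
  simp [pairing, mul_sub]

end Pairing

/-! ### Differential operators, the coadjoint action and naturality -/

section Operators

variable {m N : ℕ} {R S T : Type*} [CommRing R] [CommRing S] [CommRing T] [PartialDiffRing m S]
  [PartialDiffRing m T] [Algebra R S] [Algebra R T]

theorem divClass_pairing_coadj (c : BiDiffOp m N R) (X u Y : Fin N → S) :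
    divClass m (pairing (coadj c X u) Y) = -divClass m (pairing u (c.app X Y)) := by
  have h : pairing (coadj c X u) Y = -∑ k, ∑ p ∈ (c k).support,
      adjDpow p.2.2 (u k * (algebraMap R S (c k p) * dpow p.1.2 (X p.1.1))) * Y p.2.1 := by
    simp only [pairing, coadj, Finsupp.sum, neg_mul, Finset.sum_neg_distrib, Finset.sum_mul,
      ite_mul, zero_mul]
    rw [Finset.sum_comm]
    refine congrArg _ (Finset.sum_congr rfl fun k _ => ?_)
    rw [Finset.sum_comm]
    simp
  rw [h, map_neg, map_sum, pairing, map_sum]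
  refine congrArg _ (Finset.sum_congr rfl fun k _ => ?_)
  rw [BiDiffOp.app, Finsupp.sum, Finset.mul_sum, map_sum, map_sum]
  refine Finset.sum_congr rfl fun p _ => ?_
  rw [← divClass_mul_dpow, mul_assoc (u k)]

section Additivity

variable (c : BiDiffOp m N R) (b : DiffOp m N R)

theorem BiDiffOp.app_add_left (X Y Z : Fin N → S) :
    c.app (X + Y) Z = c.app X Z + c.app Y Z := by
  funext k
  simp [BiDiffOp.app, Finsupp.sum, mul_add, add_mul, Finset.sum_add_distrib]

theorem BiDiffOp.app_neg_left (X Z : Fin N → S) : c.app (-X) Z = -c.app X Z := by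
  funext k
  simp [BiDiffOp.app, Finsupp.sum]

theorem BiDiffOp.app_sub_left (X Y Z : Fin N → S) :
    c.app (X - Y) Z = c.app X Z - c.app Y Z := by
  rw [sub_eq_add_neg, app_add_left, app_neg_left, sub_eq_add_neg]

theorem BiDiffOp.zero_app (X Y : Fin N → S) : (0 : BiDiffOp m N R).app X Y = 0 := by
  funext k
  simp [BiDiffOp.app]

theorem DiffOp.app_add (X Y : Fin N → S) : b.app (X + Y) = b.app X + b.app Y := by
  funext k
  simp [DiffOp.app, Finsupp.sum, mul_add, Finset.sum_add_distrib]

theorem DiffOp.app_neg (X : Fin N → S) : b.app (-X) = -b.app X := by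
  funext k
  simp [DiffOp.app, Finsupp.sum]

theorem DiffOp.app_sub (X Y : Fin N → S) : b.app (X - Y) = b.app X - b.app Y := by
  rw [sub_eq_add_neg, app_add, app_neg, sub_eq_add_neg]

theorem coadj_add_left (X Y u : Fin N → S) :
    coadj c (X + Y) u = coadj c X u + coadj c Y u := by
  funext j
  simp only [coadj, Finsupp.sum, Pi.add_apply, map_add, mul_add, adjDpow_add, ← neg_add,
    ← Finset.sum_add_distrib]
  refine congrArg _ (Finset.sum_congr rfl fun k _ => Finset.sum_congr rfl fun p _ => ?_)
  split_ifs <;> simp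

theorem DiffOp.app_const_smul {k : S} (hk : ∀ l : Fin m, pd l k = 0) (X : Fin N → S) :
    b.app (k • X) = k • b.app X := by
  funext i
  simp [DiffOp.app, Finsupp.sum, dpow_const_mul hk, Finset.mul_sum, mul_left_comm]

theorem coadj_const_smul {k : S} (hk : ∀ l : Fin m, pd l k = 0) (X u : Fin N → S) :
    coadj c (k • X) u = k • coadj c X u := by
  funext i
  simp only [coadj, Finsupp.sum, Pi.smul_apply, smul_eq_mul, dpow_const_mul hk, mul_left_comm _ k,
    adjDpow_const_mul hk, mul_neg, Finset.mul_sum, mul_ite, mul_zero]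

end Additivity

section Maps

variable (c : BiDiffOp m N R) (b : DiffOp m N R)

theorem DiffOp.app_comp (f : S →ₐ[R] T) (hf : ∀ (l : Fin m) a, f (pd l a) = pd l (f a))
    (X : Fin N → S) : b.app (f ∘ X) = f ∘ b.app X := by
  have h := map_dpow (f : S →+ T) hf
  funext i
  simp only [AddMonoidHom.coe_coe] at h
  simp [DiffOp.app, Finsupp.sum, h]

theorem BiDiffOp.app_comp (f : S →ₐ[R] T) (hf : ∀ (l : Fin m) a, f (pd l a) = pd l (f a))
    (X Y : Fin N → S) : c.app (f ∘ X) (f ∘ Y) = f ∘ c.app X Y := by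
  have h := map_dpow (f : S →+ T) hf
  funext i
  simp only [AddMonoidHom.coe_coe] at h
  simp [BiDiffOp.app, Finsupp.sum, h]

theorem coadj_comp (f : S →ₐ[R] T) (hf : ∀ (l : Fin m) a, f (pd l a) = pd l (f a))
    (X u : Fin N → S) : coadj c (f ∘ X) (f ∘ u) = f ∘ coadj c X u := by
  have h := map_dpow (f : S →+ T) hf
  have h' := map_adjDpow (f : S →+ T) hf
  funext i
  simp only [AddMonoidHom.coe_coe] at h h'
  simp [coadj, Finsupp.sum, h, h', apply_ite f]

variable (D : Derivation R S S) (hD : ∀ (l : Fin m) a, D (pd l a) = pd l (D a))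
include hD

theorem derivation_dpow (σ : Fin m → ℕ) (a : S) : D (dpow σ a) = dpow σ (D a) :=
  map_dpow (D : S →+ S) hD σ a

theorem derivation_adjDpow (σ : Fin m → ℕ) (a : S) : D (adjDpow σ a) = adjDpow σ (D a) :=
  map_adjDpow (D : S →+ S) hD σ a

theorem derivation_app (X : Fin N → S) : D ∘ b.app X = b.app (D ∘ X) := by
  funext i
  simp [DiffOp.app, Finsupp.sum, derivation_dpow D hD]

theorem derivation_biapp (X Y : Fin N → S) :
    D ∘ c.app X Y = c.app (D ∘ X) Y + c.app X (D ∘ Y) := by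
  funext i
  simp only [BiDiffOp.app, Finsupp.sum, Function.comp_apply, map_sum, Pi.add_apply,
    ← Finset.sum_add_distrib]
  refine Finset.sum_congr rfl fun p _ => ?_
  simp [derivation_dpow D hD]
  ring

/-- The coefficients of the operator `u ↦ X.u` are built from `R` and `X`, both killed by `D`, so
`D` passes through to `u`. -/
theorem derivation_coadj {X : Fin N → S} (hX : D ∘ X = 0) (u : Fin N → S) :
    D ∘ coadj c X u = coadj c X (D ∘ u) := by
  have hX' : ∀ i, D (X i) = 0 := congrFun hX
  funext i
  simp only [coadj, Finsupp.sum, Function.comp_apply, map_sum, map_neg, apply_ite D, map_zero,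
    derivation_adjDpow D hD]
  refine congrArg _ (Finset.sum_congr rfl fun k _ => Finset.sum_congr rfl fun p _ => ?_)
  simp [derivation_dpow D hD, hX', mul_comm]

omit hD in
theorem derivation_pairing (X Y : Fin N → S) :
    D (pairing X Y) = pairing (D ∘ X) Y + pairing X (D ∘ Y) := by
  simp [pairing, ← Finset.sum_add_distrib, mul_comm, add_comm]

end Maps

end Operators

/-! ### Evolution derivations and the first variation formula -/

section DiffPoly

variable {m N : ℕ} {R : Type*} [CommRing R] [PartialDiffRing m R]

theorem pd_C (l : Fin m) (a : R) : pd l (C a : DiffPoly m N R) = C (pd l a) := totalDer_C l a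

theorem pd_X (l : Fin m) (p : Jet m N) :
    pd l (X p : DiffPoly m N R) = X (p.1, p.2 + Pi.single l 1) := totalDer_X l p

theorem evolDer_uVec (a : Fin N → DiffPoly m N R) : evolDer a ∘ uVec = a := by
  funext i
  simp [evolDer, uVec, mkDerivation_X, dpow_zero]

theorem evolDer_comp_constVec (a : Fin N → DiffPoly m N R) (X : Fin N → R) :
    evolDer a ∘ constVec X = 0 := by
  funext i
  exact derivation_C _ _

theorem evolDer_pd (a : Fin N → DiffPoly m N R) (l : Fin m) (H : DiffPoly m N R) :
    evolDer a (pd l H) = pd l (evolDer a H) := by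
  induction H using MvPolynomial.induction_on with
  | C r => rw [pd_C, derivation_C, derivation_C, map_zero]
  | add p q hp hq => simp only [map_add, hp, hq]
  | mul_X p j hp =>
    rw [Derivation.leibniz, Derivation.leibniz, map_add, map_add, smul_eq_mul, smul_eq_mul,
      smul_eq_mul, smul_eq_mul, Derivation.leibniz, Derivation.leibniz, Derivation.leibniz,
      Derivation.leibniz, hp, pd_X]
    simp only [evolDer, mkDerivation_X, dpow_add_single, smul_eq_mul]
    ring

theorem evolDer_add (a a' : Fin N → DiffPoly m N R) :
    evolDer (a + a') = evolDer a + evolDer a' := by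
  refine derivation_ext fun p => ?_
  rw [Derivation.add_apply]
  simp only [evolDer, mkDerivation_X, Pi.add_apply]
  exact map_add (dpow p.2) _ _

theorem evolDer_neg (a : Fin N → DiffPoly m N R) : evolDer (-a) = -evolDer a := by
  refine derivation_ext fun p => ?_
  rw [Derivation.neg_apply]
  simp only [evolDer, mkDerivation_X, Pi.neg_apply]
  exact map_neg (dpow p.2) _

theorem evolDer_const_smul {k : R} (hk : ∀ l : Fin m, pd l k = 0)
    (a : Fin N → DiffPoly m N R) : evolDer ((C k : DiffPoly m N R) • a) = k • evolDer a := by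
  refine derivation_ext fun p => ?_
  rw [Derivation.smul_apply]
  simp only [evolDer, mkDerivation_X, Pi.smul_apply, smul_eq_mul]
  rw [dpow_const_mul (fun l => by rw [pd_C, hk, C_0]), smul_eq_C_mul]

theorem evolDer_lie (a a' : Fin N → DiffPoly m N R) :
    ⁅evolDer a, evolDer a'⁆ = evolDer (evolDer a ∘ a' - evolDer a' ∘ a) := by
  refine derivation_ext fun p => ?_
  have h (a : Fin N → DiffPoly m N R) : evolDer a (X p) = dpow p.2 (a p.1) := by
    rw [evolDer, mkDerivation_X]
  rw [Derivation.commutator_apply, h, h, h, derivation_dpow _ (evolDer_pd a),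
    derivation_dpow _ (evolDer_pd a')]
  exact (map_sub (dpow p.2) _ _).symm

/-- First variation formula: expand by the chain rule, then integrate each term by parts. -/
theorem divClass_evolDer (a : Fin N → DiffPoly m N R) (H : DiffPoly m N R) :
    divClass m (evolDer a H) = divClass m (pairing (varDer H) a) := by
  classical
  have h : evolDer a H = ∑ p ∈ H.vars, pderiv p H * dpow p.2 (a p.1) := by
    -- A finite truncation of the chain rule. It need not equal `evolDer a`, but it agrees with it
    -- on the variables of `H`, hence at `H`.
    let D : Derivation R (DiffPoly m N R) (DiffPoly m N R) :=
      ∑ p ∈ H.vars, dpow p.2 (a p.1) • pderiv p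
    have hD (F : DiffPoly m N R) : D F = ∑ p ∈ H.vars, pderiv p F * dpow p.2 (a p.1) := by
      have := congrArg (fun f => f F)
        (map_sum (Derivation.coeFnAddMonoidHom (R := R) (A := DiffPoly m N R)
          (M := DiffPoly m N R)) (fun p => dpow p.2 (a p.1) • pderiv p) H.vars)
      simpa only [D, Derivation.coeFnAddMonoidHom, AddMonoidHom.coe_mk, ZeroHom.coe_mk,
        Finset.sum_apply, Derivation.coe_smul, Pi.smul_apply, smul_eq_mul, mul_comm] using this
    rw [← hD]
    refine derivation_eq_of_forall_mem_vars fun p hp => ?_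
    rw [hD, evolDer, mkDerivation_X, Finset.sum_eq_single_of_mem p hp]
    · simp
    · intro q _ hq
      rw [pderiv_X_of_ne hq.symm, zero_mul]
  have h' : pairing (varDer H) a = ∑ p ∈ H.vars, adjDpow p.2 (pderiv p H) * a p.1 := by
    simp only [pairing, varDer, Finset.sum_mul, ite_mul, zero_mul]
    rw [Finset.sum_comm]
    simp
  rw [h, h', map_sum, map_sum]
  exact Finset.sum_congr rfl fun p _ => divClass_mul_dpow _ _ _

end DiffPoly

/-! ### Nondegeneracy of the pairing with a generic vector -/

section NonDegeneracy

variable {m N : ℕ} {S : Type*} [CommRing S]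

/-- The coefficients of `u_i^(σ)` in the linear part of a differential polynomial. -/
noncomputable def linearCoeff (i : Fin N) (f : DiffPoly m N S) : (Fin m → ℕ) →₀ S :=
  (AddMonoidAlgebra.coeff f).comapDomain (fun σ => Finsupp.single (i, σ) 1) fun σ _ τ _ h => by
    simpa using Finsupp.single_left_injective one_ne_zero h

theorem linearCoeff_apply (i : Fin N) (f : DiffPoly m N S) (σ : Fin m → ℕ) :
    linearCoeff i f σ = coeff (Finsupp.single (i, σ) 1) f := rfl

theorem coeff_single_mul_X [DecidableEq (Jet m N)] (p j : Jet m N) (f : DiffPoly m N S) :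
    coeff (Finsupp.single p 1) (f * X j) = if p = j then coeff 0 f else 0 := by
  rw [coeff_mul_X']
  by_cases h : p = j
  · subst h
    simp
  · simp [h, Ne.symm h]

theorem linearCoeff_mul_X (i : Fin N) (f : DiffPoly m N S) (j : Jet m N) :
    linearCoeff i (f * X j) = if i = j.1 then Finsupp.single j.2 (coeff 0 f) else 0 := by
  classical
  ext σ
  rw [linearCoeff_apply, coeff_single_mul_X]
  by_cases h : i = j.1
  · simp [h, Finsupp.single_apply, Prod.ext_iff, eq_comm]
  · simp [h, Prod.ext_iff]

theorem linearCoeff_add (i : Fin N) (f g : DiffPoly m N S) :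
    linearCoeff i (f + g) = linearCoeff i f + linearCoeff i g := by
  ext σ
  simp [linearCoeff_apply]

theorem linearCoeff_C (i : Fin N) (a : S) : linearCoeff (m := m) i (C a) = 0 := by
  classical
  ext σ
  rw [linearCoeff_apply, coeff_C, if_neg (Finsupp.single_ne_zero.2 one_ne_zero).symm]
  rfl

variable [PartialDiffRing m S]

theorem coeff_zero_pd (l : Fin m) (f : DiffPoly m N S) :
    coeff 0 (pd l f) = pd l (coeff 0 f) := by
  classical
  induction f using MvPolynomial.induction_on with
  | C r => rw [pd_C, coeff_zero_C, coeff_zero_C]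
  | add p q hp hq => simp only [map_add, coeff_add, hp, hq]
  | mul_X p j hp =>
    rw [Derivation.leibniz, pd_X, smul_eq_mul, smul_eq_mul, mul_comm (X j), coeff_add]
    simp [coeff_mul_X']

/-- The variational derivative of the linear part of a differential polynomial. -/
noncomputable def linearVarDer (i : Fin N) : DiffPoly m N S →+ S where
  toFun f := (linearCoeff i f).sum fun σ a => adjDpow σ a
  map_zero' := by
    rw [← C_0, linearCoeff_C, Finsupp.sum_zero_index]
  map_add' f g := by
    rw [linearCoeff_add, Finsupp.sum_add_index'] <;> simp [adjDpow, mul_add]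

theorem linearVarDer_mul_X (i : Fin N) (f : DiffPoly m N S) (j : Jet m N) :
    linearVarDer i (f * X j) = if i = j.1 then adjDpow j.2 (coeff 0 f) else 0 := by
  change (linearCoeff i (f * X j)).sum (fun σ a => adjDpow σ a) = _
  rw [linearCoeff_mul_X]
  split_ifs
  · exact Finsupp.sum_single_index (by simp [adjDpow])
  · exact Finsupp.sum_zero_index

/-- On a linear term, `∂_l (a u^(σ)) = (∂_l a) u^(σ) + a u^(σ+e_l)`, and the adjoints of the two
summands cancel. Constant and higher-order terms contribute nothing linear. -/
theorem linearVarDer_pd (i : Fin N) (l : Fin m) (f : DiffPoly m N S) :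
    linearVarDer i (pd l f) = 0 := by
  induction f using MvPolynomial.induction_on with
  | C r =>
    change (linearCoeff i _).sum (fun σ a => adjDpow σ a) = _
    rw [pd_C, linearCoeff_C, Finsupp.sum_zero_index]
  | add p q hp hq => simp only [map_add, hp, hq, add_zero]
  | mul_X p j hp =>
    rw [Derivation.leibniz, pd_X, smul_eq_mul, smul_eq_mul, mul_comm (X j), map_add,
      linearVarDer_mul_X, linearVarDer_mul_X, coeff_zero_pd, adjDpow_add_single]
    split_ifs <;> simp

/-- `linearVarDer i` kills divergences and reads off `v i` from `⟨v, u⟩`. This upgrades identities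
modulo divergences to equalities. -/
theorem eq_of_divClass_pairing_uVec {v w : Fin N → S}
    (h : divClass m (pairing (constVec v : Fin N → DiffPoly m N S) uVec) =
      divClass m (pairing (constVec w) uVec)) : v = w := by
  have key (v : Fin N → S) (i : Fin N) :
      linearVarDer i (pairing (constVec v : Fin N → DiffPoly m N S) uVec) = v i := by
    simp [pairing, constVec, uVec, linearVarDer_mul_X, adjDpow_zero]
  obtain ⟨z, hz⟩ := divEquiv_iff.2 h
  funext i
  have := congrArg (linearVarDer i) hz
  rwa [map_sub, key, key, map_sum, Finset.sum_eq_zero fun l _ => linearVarDer_pd i l _,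
    sub_eq_zero] at this

end NonDegeneracy

/-! ### Constant vectors and passage to a larger differential extension -/

section ConstVec

variable {m N : ℕ} {S : Type*} [CommRing S]

theorem constVec_add (v w : Fin N → S) :
    (constVec (v + w) : Fin N → DiffPoly m N S) = constVec v + constVec w :=
  funext fun _ => C_add

theorem constVec_sub (v w : Fin N → S) :
    (constVec (v - w) : Fin N → DiffPoly m N S) = constVec v - constVec w :=
  funext fun _ => C_sub ..

end ConstVec

section Extension

variable {m N : ℕ} {R S : Type*} [CommRing R] [CommRing S] [PartialDiffRing m S]
  [Algebra R S]

-- Lets the hypotheses on the bracket and on `b` be used after adjoining generic indeterminates to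
-- `S`, in particular when `S` is already `C_u`.
instance [PartialDiffRing m R] [DiffExtension m R S] : DiffExtension m R (DiffPoly m N S) where
  injective := by
    rw [IsScalarTower.algebraMap_eq R S (DiffPoly m N S)]
    exact (MvPolynomial.C_injective _ _).comp (DiffExtension.injective m)
  map_der l a := by
    rw [IsScalarTower.algebraMap_apply R S (DiffPoly m N S), algebraMap_eq, pd_C,
      DiffExtension.map_der, IsScalarTower.algebraMap_apply R S (DiffPoly m N S), algebraMap_eq]

variable (N) in
/-- The inclusion of constants `S → S[u_i^(σ)]` over a base ring `R`. -/
noncomputable def constHom (R S : Type*) [CommRing R] [CommRing S] [Algebra R S] :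
    S →ₐ[R] DiffPoly m N S :=
  IsScalarTower.toAlgHom R S (DiffPoly m N S)

theorem constHom_pd (l : Fin m) (a : S) :
    (constHom N R S (pd l a) : DiffPoly m N S) = (pd l (constHom N R S a : DiffPoly m N S)) := (pd_C l a).symm

theorem app_constVec (b : DiffOp m N R) (X : Fin N → S) :
    b.app (constVec X : Fin N → DiffPoly m N S) = constVec (b.app X) :=
  b.app_comp (constHom N R S) constHom_pd X

theorem biapp_constVec (c : BiDiffOp m N R) (X Y : Fin N → S) :
    c.app (constVec X : Fin N → DiffPoly m N S) (constVec Y) = constVec (c.app X Y) :=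
  c.app_comp (constHom N R S) constHom_pd X Y

theorem coadj_constVec (c : BiDiffOp m N R) (X u : Fin N → S) :
    coadj c (constVec X : Fin N → DiffPoly m N S) (constVec u) = constVec (coadj c X u) :=
  coadj_comp c (constHom N R S) constHom_pd X u

end Extension

/-! ### The affine coadjoint action -/

section Coadjoint

variable {m N : ℕ} {R : Type u} [CommRing R] [PartialDiffRing m R]
  {S : Type u} [CommRing S] [PartialDiffRing m S] [Algebra R S] [DiffExtension m R S]
  {c : BiDiffOp m N R} {b : DiffOp m N R}

theorem divClass_pairing_app_comm (hb : IsGenTwoCocycle c b) (X Y : Fin N → S) :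
    divClass m (pairing (b.app X) Y) = -divClass m (pairing (b.app Y) X) := by
  rw [← map_neg]
  exact divEquiv_iff.1 (hb.skew S X Y)

theorem divClass_cocycle (hb : IsGenTwoCocycle c b) (X Y Z : Fin N → S) :
    divClass m (pairing (b.app (c.app X Y)) Z) + divClass m (pairing (b.app (c.app Y Z)) X)
      + divClass m (pairing (b.app (c.app Z X)) Y) = 0 := by
  rw [← map_add, ← map_add, ← map_zero (divClass m)]
  exact divEquiv_iff.1 (hb.cocycle S X Y Z)

/-- Jacobi in the form that rewrites left-nested brackets as right-nested ones, serving as a normal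
form for `simp`. -/
theorem leibniz_of_isDiffLieAlgebra (hc : IsDiffLieAlgebra c) (X Y Z : Fin N → S) :
    c.app (c.app X Y) Z = c.app X (c.app Y Z) - c.app Y (c.app X Z) := by
  have h := hc.jacobi S X Y Z
  rw [hc.skew S (c.app Y Z) X, hc.skew S Z X, BiDiffOp.app_neg_left,
    hc.skew S (c.app X Z) Y] at h
  rw [← sub_eq_zero, ← h]
  abel

/-- The affine coadjoint action `u ↦ X.u - b(X)` respects the bracket. -/
theorem affine_coadj_bracket (hc : IsDiffLieAlgebra c) (hb : IsGenTwoCocycle c b)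
    (X Y u : Fin N → S) :
    coadj c (c.app X Y) u - b.app (c.app X Y) =
      coadj c X (coadj c Y u - b.app Y) - coadj c Y (coadj c X u - b.app X) := by
  -- Test against generic indeterminates over `S`: the identity then only has to hold paired and
  -- modulo divergences.
  refine eq_of_divClass_pairing_uVec (m := m) ?_
  simp only [constVec_sub, ← coadj_constVec, ← app_constVec, ← biapp_constVec]
  generalize (constVec X : Fin N → DiffPoly m N S) = X'
  generalize (constVec Y : Fin N → DiffPoly m N S) = Y'
  generalize (constVec u : Fin N → DiffPoly m N S) = u'
  generalize (uVec : Fin N → DiffPoly m N S) = Z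
  have h := divClass_cocycle hb X' Y' Z
  -- Skewness brings the cocycle identity to the form in which `b` acts on `[X', Y']`, `X'` and
  -- `Y'`, as in the goal.
  rw [divClass_pairing_app_comm hb (c.app Y' Z), divClass_pairing_app_comm hb (c.app Z X'),
    hc.skew _ Z X', pairing_neg_right, map_neg] at h
  simp only [pairing_sub_left, map_sub, divClass_pairing_coadj, leibniz_of_isDiffLieAlgebra hc,
    pairing_sub_right]
  rw [← sub_eq_zero, ← neg_eq_zero, ← h]
  abel

end Coadjoint

/-! ### The modified action and the affine bracket -/

section ModifiedAction

variable {m N : ℕ} {R : Type u} [CommRing R] [PartialDiffRing m R]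
  {c : BiDiffOp m N R} {b : DiffOp m N R}

theorem modifiedAction_pd (X : Fin N → R) (l : Fin m) (H : DiffPoly m N R) :
    modifiedAction c b X (pd l H) = pd l (modifiedAction c b X H) := evolDer_pd _ l H

/-- X^ kills `b(Y)`, whose entries lie in `R`, and acts on `Y.u` only through `u`. -/
theorem modifiedAction_comp_affine (X Y : Fin N → R) :
    modifiedAction c b X ∘ (coadj c (constVec Y) uVec - b.app (constVec Y)) =
      coadj c (constVec Y) (coadj c (constVec X) uVec - b.app (constVec X)) := by
  have h := derivation_coadj c (modifiedAction c b X) (modifiedAction_pd X)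
    (evolDer_comp_constVec _ Y) uVec
  have h' := congrFun (evolDer_comp_constVec (coadj c (constVec X) uVec - b.app (constVec X) :
    Fin N → DiffPoly m N R) (b.app Y))
  rw [← app_constVec] at h'
  funext i
  rw [Function.comp_apply, Pi.sub_apply, map_sub, ← Function.comp_apply (f := modifiedAction c b X),
    h]
  refine (congrArg _ (h' i)).trans ?_
  rw [Pi.zero_apply, sub_zero, modifiedAction, evolDer_uVec]

theorem isEvolutionAntirep_modifiedAction (hc : IsDiffLieAlgebra c) (hb : IsGenTwoCocycle c b) :
    IsEvolutionAntirep c (modifiedAction c b) where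
  evolution := modifiedAction_pd
  map_add X Y := by
    rw [modifiedAction, modifiedAction, modifiedAction, ← evolDer_add, constVec_add,
      coadj_add_left, DiffOp.app_add]
    congr 1
    abel
  map_const_smul k hk X := by
    have hC (l : Fin m) : pd l (C k : DiffPoly m N R) = 0 := by rw [pd_C, hk, C_0]
    have hX : (constVec (k • X) : Fin N → DiffPoly m N R) =
        (C k : DiffPoly m N R) • constVec X := funext fun _ => C_mul
    rw [modifiedAction, modifiedAction, ← evolDer_const_smul hk, hX, coadj_const_smul c hC,
      DiffOp.app_const_smul b hC, smul_sub]
  map_bracket X Y := by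
    have h := modifiedAction_comp_affine (c := c) (b := b)
    simp only [modifiedAction] at h ⊢
    rw [evolDer_lie, h, h, ← evolDer_neg, ← biapp_constVec, affine_coadj_bracket hc hb, neg_sub]

/-- `X^` intertwines the variational derivative with `X^ - ad X`, modulo divergences. -/
theorem divClass_varDer_modifiedAction (X : Fin N → R) (H : DiffPoly m N R)
    (Y : Fin N → DiffPoly m N R) :
    divClass m (pairing (varDer (modifiedAction c b X H)) Y) =
      divClass m (pairing (modifiedAction c b X ∘ varDer H) Y)
        - divClass m (pairing (c.app (constVec X) (varDer H)) Y) := by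
  set a : Fin N → DiffPoly m N R := coadj c (constVec X) uVec - b.app (constVec X) with ha
  have hY : evolDer Y ∘ a = coadj c (constVec X) Y := by
    have h := congrFun (derivation_coadj c (evolDer Y) (evolDer_pd Y)
      (evolDer_comp_constVec _ X) uVec)
    have h' := congrFun (evolDer_comp_constVec Y (b.app X))
    rw [← app_constVec] at h'
    funext i
    have hi := h i
    have hi' := h' i
    rw [evolDer_uVec] at hi
    simp only [Function.comp_apply, Pi.zero_apply] at hi hi'
    simp [ha, hi, hi']
  -- Evaluate the commutator of Y^ and X^ at `H`: both iterated variations reduce to pairings with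
  -- δH/δu, and the terms containing X^(Y) cancel.
  have hcomm := congrArg (fun D => D H) (evolDer_lie Y a)
  simp only [Derivation.commutator_apply, hY] at hcomm
  rw [sub_eq_iff_eq_add] at hcomm
  have hD := divClass_map_congr (evolDer a : DiffPoly m N R →+ DiffPoly m N R) (evolDer_pd a)
    (divClass_evolDer Y H)
  simp only [AddMonoidHom.coe_coe] at hD
  rw [← divClass_evolDer, modifiedAction, ← ha, hcomm, map_add, hD, divClass_evolDer,
    derivation_pairing, map_add, pairing_sub_right, map_sub, pairing_comm (varDer H) (coadj _ _ _),
    divClass_pairing_coadj, pairing_comm Y]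
  abel

variable (c b) in
/-- The affine bracket as a bilinear form on variational derivatives. -/
noncomputable def affineForm (h f : Fin N → DiffPoly m N R) :
    DiffPoly m N R ⧸ divergences m (DiffPoly m N R) :=
  divClass m (pairing uVec (c.app h f)) + divClass m (pairing (b.app h) f)

/-- Isolates `h` as a bare factor of the pairing, so that `h` may be replaced by anything with the
same pairings modulo divergences. -/
theorem affineForm_eq (hc : IsDiffLieAlgebra c) (hb : IsGenTwoCocycle c b)
    (h f : Fin N → DiffPoly m N R) :
    affineForm c b h f = divClass m (pairing h (coadj c f uVec - b.app f)) := by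
  rw [affineForm, hc.skew _ h f, pairing_neg_right, map_neg, ← divClass_pairing_coadj,
    divClass_pairing_app_comm hb, ← sub_eq_add_neg, ← map_sub, ← pairing_sub_left, pairing_comm]

theorem affineForm_skew (hc : IsDiffLieAlgebra c) (hb : IsGenTwoCocycle c b)
    (h f : Fin N → DiffPoly m N R) : affineForm c b h f = -affineForm c b f h := by
  rw [affineForm, affineForm, hc.skew _ h f, pairing_neg_right, map_neg,
    divClass_pairing_app_comm hb, neg_add]

theorem affineForm_varDer_left (hc : IsDiffLieAlgebra c) (hb : IsGenTwoCocycle c b)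
    (X : Fin N → R) (H : DiffPoly m N R) (f : Fin N → DiffPoly m N R) :
    affineForm c b (varDer (modifiedAction c b X H)) f =
      affineForm c b (modifiedAction c b X ∘ varDer H - c.app (constVec X) (varDer H)) f := by
  rw [affineForm_eq hc hb, affineForm_eq hc hb, divClass_varDer_modifiedAction, pairing_sub_left,
    map_sub]

theorem affineForm_varDer_right (hc : IsDiffLieAlgebra c) (hb : IsGenTwoCocycle c b)
    (X : Fin N → R) (h : Fin N → DiffPoly m N R) (F : DiffPoly m N R) :
    affineForm c b h (varDer (modifiedAction c b X F)) =
      affineForm c b h (modifiedAction c b X ∘ varDer F - c.app (constVec X) (varDer F)) := by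
  rw [affineForm_skew hc hb, affineForm_varDer_left hc hb, ← affineForm_skew hc hb]

theorem divClass_modifiedAction_affineBracket (hc : IsDiffLieAlgebra c)
    (hb : IsGenTwoCocycle c b) (X : Fin N → R) (H F : DiffPoly m N R) :
    divClass m (modifiedAction c b X (affineBracket c b H F)) =
      divClass m (affineBracket c b (modifiedAction c b X H) F) +
        divClass m (affineBracket c b H (modifiedAction c b X F)) := by
  have key (H F : DiffPoly m N R) :
      divClass m (affineBracket c b H F) = affineForm c b (varDer H) (varDer F) := map_add ..
  have hu : modifiedAction c b X ∘ uVec = coadj c (constVec X) uVec - b.app (constVec X) :=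
    evolDer_uVec _
  rw [key, key, affineForm_varDer_left hc hb, affineForm_varDer_right hc hb, affineBracket,
    map_add, derivation_pairing, derivation_pairing, hu,
    derivation_biapp c _ (modifiedAction_pd X), derivation_app b _ (modifiedAction_pd X)]
  generalize modifiedAction c b X ∘ varDer H = h'
  generalize modifiedAction c b X ∘ varDer F = f'
  generalize varDer H = h
  generalize varDer F = f
  generalize (constVec X : Fin N → DiffPoly m N R) = x
  -- The terms with `h'` and `f'` match on both sides. What remains is Jacobi for `x, h, f` paired
  -- with `u`, plus this cocycle identity.
  have hcoc := divClass_cocycle hb x h f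
  rw [divClass_pairing_app_comm hb (c.app h f), hc.skew _ f x, DiffOp.app_neg, pairing_neg_left,
    map_neg, divClass_pairing_app_comm hb (c.app x f)] at hcoc
  -- Skewness is instantiated at specific arguments, since the general rule would loop; it moves
  -- differences and nested brackets into the left slot, where the expansion rules apply.
  simp only [affineForm, pairing_sub_left, pairing_sub_right, map_add, map_sub,
    divClass_pairing_coadj, BiDiffOp.app_sub_left, DiffOp.app_sub, leibniz_of_isDiffLieAlgebra hc,
    hc.skew _ h (f' - c.app x f), hc.skew _ h f', hc.skew _ h (c.app x f), pairing_add_right,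
    pairing_neg_right, map_neg]
  rw [← sub_eq_zero, ← hcoc]
  abel

/-- The witness is minus the affine field of δH/δu: by skewness of the bracket and of `b`, `⟨δH/δu,
X.u - b(X)⟩` changes sign when δH/δu and `X` are exchanged. -/
theorem isDualMap_modifiedAction (hb : IsGenTwoCocycle c b) (hc : IsDiffLieAlgebra c) :
    IsDualMap (modifiedAction c b) fun H => b.app (varDer H) - coadj c (varDer H) uVec := by
  intro H X
  rw [divEquiv_iff, modifiedAction, divClass_evolDer, pairing_sub_left, pairing_sub_right,
    map_sub, map_sub, divClass_pairing_coadj, divClass_pairing_app_comm hb,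
    pairing_comm _ (coadj _ _ _), divClass_pairing_coadj, hc.skew _ (constVec X),
    pairing_neg_right, map_neg, pairing_comm (varDer H)]
  abel

end ModifiedAction

theorem theorem5p55 {m N : ℕ} {R : Type u} [CommRing R] [PartialDiffRing m R]
    (c : BiDiffOp m N R) (hc : IsDiffLieAlgebra c)
    (b : DiffOp m N R) (hb : IsGenTwoCocycle c b)
    (PB : DiffPoly m N R → DiffPoly m N R → DiffPoly m N R)
    (hPB : ∀ H F, DivEquiv m (PB H F) (affineBracket c b H F)) :
    IsEvolutionAntirep c (modifiedAction c b) ∧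
      IsInfHamiltonianAction (0 : BiDiffOp m N R) PB (modifiedAction c b) := by
  refine ⟨isEvolutionAntirep_modifiedAction hc hb, ⟨_, isDualMap_modifiedAction hb hc⟩, ?_⟩
  intro tld _ H F X
  -- `PB` is an arbitrary representative of the bracket; X^ commutes with all `∂_l`, so it preserves
  -- divergences and the choice does not matter.
  have hPB' (H F) := divEquiv_iff.1 (hPB H F)
  have h := divClass_map_congr (modifiedAction c b X : DiffPoly m N R →+ DiffPoly m N R)
    (modifiedAction_pd X) (hPB' H F)
  simp only [AddMonoidHom.coe_coe] at h
  have h0 : pairing (0 : Fin N → DiffPoly m N R) (constVec X) = 0 := by simp [pairing]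
  rw [divEquiv_iff, map_sub, map_sub, h, hPB', hPB', BiDiffOp.zero_app, h0, map_zero,
    divClass_modifiedAction_affineBracket hc hb]
  abel
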